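/- A semigroup identity $u\approx v$ is a pair of elements $u,v$ of the free semigroup over a countably infinite alphabet. A semigroup variety is the class of all semigroups satisfying some given set of identities. The semigroup varieties form a lattice under inclusion, in which the meet of two varieties is their intersection and their join is the variety generated by their union. Let $\mathbf{OC}$ be the sublattice of all overcommutative varieties, that is, of those semigroup varieties that contain every commutative semigroup. An element $x$ of a lattice $L$ is called distributive if $x\vee(y\wedge z)=(x\vee y)\wedge(x\vee z)$ for all $y,z\in L$, and codistributive if $x\wedge(y\vee z)=(x\wedge y)\vee(x\wedge z)$ for all $y,z\in L$. Corollary. The set of all distributive elements of the lattice $\mathbf{OC}$ is countably infinite, and the set of all codistributive elements of the lattice $\mathbf{OC}$ is countably infinite. -/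

import Mathlib

universe u

/-- A semigroup identity `p.1 ≈ p.2`: a pair of words, that is, of elements of the free semigroup
over the countably infinite alphabet `{x₀, x₁, x₂, …}`. -/
abbrev SemigroupIdentity : Type := FreeSemigroup ℕ × FreeSemigroup ℕ

/-- The semigroup `S` satisfies the identity `p`: both sides take the same value under every
assignment of elements of `S` to the letters. -/
def SatisfiesIdentity (S : Type u) [Semigroup S] (p : SemigroupIdentity) : Prop :=
  ∀ f : ℕ → S, FreeSemigroup.lift f p.1 = FreeSemigroup.lift f p.2

/-- The class of all semigroups that satisfy every identity in `E`. -/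
def semigroupModels (E : Set SemigroupIdentity) : Set Semigrp.{u} :=
  {S | ∀ p ∈ E, SatisfiesIdentity S p}

/-- The set of all identities that hold in every semigroup of the class `K`. -/
def commonIdentities (K : Set Semigrp.{u}) : Set SemigroupIdentity :=
  {p | ∀ S ∈ K, SatisfiesIdentity S p}

/-- A semigroup variety: a class of semigroups that is defined by some set of identities. -/
@[ext]
structure SemigroupVariety : Type (u + 1) where
  carrier : Set Semigrp.{u}
  equational : ∃ E : Set SemigroupIdentity, carrier = semigroupModels E

namespace SemigroupVariety

/-- The variety generated by a class of semigroups. -/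
def generated (K : Set Semigrp.{u}) : SemigroupVariety.{u} where
  carrier := semigroupModels (commonIdentities K)
  equational := ⟨_, rfl⟩

theorem subset_generated (K : Set Semigrp.{u}) : K ⊆ (generated K).carrier :=
  fun S hS _ hp => hp S hS

theorem generated_subset {K : Set Semigrp.{u}} {V : SemigroupVariety.{u}} (h : K ⊆ V.carrier) :
    (generated K).carrier ⊆ V.carrier := by
  obtain ⟨E, hE⟩ := V.equational
  rw [hE] at h ⊢
  exact fun S hS p hp => hS p fun T hT => h hT p hp

/-- Varieties are ordered by inclusion of classes. -/
instance : PartialOrder SemigroupVariety.{u} :=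
  PartialOrder.lift SemigroupVariety.carrier fun _ _ h => SemigroupVariety.ext h

/-- The lattice of all semigroup varieties: the join is the variety generated by the union, the
meet is the intersection. -/
instance : Lattice SemigroupVariety.{u} where
  sup V W := generated (V.carrier ∪ W.carrier)
  le_sup_left _ _ := Set.subset_union_left.trans (subset_generated _)
  le_sup_right _ _ := Set.subset_union_right.trans (subset_generated _)
  sup_le _ _ _ hV hW := generated_subset (Set.union_subset hV hW)
  inf V W :=
    { carrier := V.carrier ∩ W.carrier
      equational := by
        obtain ⟨E, hE⟩ := V.equational
        obtain ⟨E', hE'⟩ := W.equational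
        refine ⟨E ∪ E', ?_⟩
        rw [hE, hE']
        ext S
        simp only [semigroupModels, Set.mem_inter_iff, Set.mem_ofPred_eq, Set.mem_union, or_imp,
          forall_and] }
  inf_le_left _ _ := Set.inter_subset_left
  inf_le_right _ _ := Set.inter_subset_right
  le_inf _ _ _ hV hW := Set.subset_inter hV hW

/-- A variety is overcommutative if it contains every commutative semigroup. -/
def IsOvercommutative (V : SemigroupVariety.{u}) : Prop :=
  ∀ S : Semigrp.{u}, (∀ a b : S, a * b = b * a) → S ∈ V.carrier

/-- The sublattice of all overcommutative semigroup varieties. -/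
def OC : Sublattice SemigroupVariety.{u} where
  carrier := {V | V.IsOvercommutative}
  supClosed' := fun _ hV _ _ S hS => subset_generated _ (Or.inl (hV S hS))
  infClosed' := fun _ hV _ hW S hS => ⟨hV S hS, hW S hS⟩

end SemigroupVariety

/-- `x` is a distributive element of the lattice `L`. -/
def IsDistributiveElement {L : Type*} [Lattice L] (x : L) : Prop :=
  ∀ y z : L, x ⊔ (y ⊓ z) = (x ⊔ y) ⊓ (x ⊔ z)

/-- `x` is a codistributive element of the lattice `L`. -/
def IsCodistributiveElement {L : Type*} [Lattice L] (x : L) : Prop :=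
  ∀ y z : L, x ⊓ (y ⊔ z) = (x ⊓ y) ⊔ (x ⊓ z)

/-! Passing to identities turns the lattice of overcommutative varieties upside down: it becomes the
lattice of fully invariant congruences ("theories") inside the commutative congruence on the free
semigroup. Distributive varieties correspond to codistributive theories and conversely
(`isDistributiveElement_iff`, `isCodistributiveElement_iff`).

For the upper bound, both kinds of theory are greedy: a word identified with any other word is
identified with all rearrangements of itself. To see this, restrict to words of fixed length using
exactly the letters of a finite set. Theories become equivalence relations stable under renaming.
Restriction respects joins (`IsTheory.comap_sup_le`), and every stable relation is the restriction
of a theory (`isTheory_extend`, `comap_extend`), so (co)distributivity descends. There it is tested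
on relations generated by one pair of words (`rel_permute_of_codistributive`,
`rel_permute_of_distributive`).

A greedy theory is determined by its non-isolated words. Up to renaming and rearranging, these are
closed under adding letters, so by Higman's lemma finitely many words generate them. Hence greedy
theories are countable in number. For the lower bound, the theories `longTheory n` are both
distributive and codistributive, and infinitely many of them are distinct. -/

namespace OvercommutativeTheory

open Equiv

/-! ### Stable relations on words of fixed length and alphabet -/

theorem sup_le_of_rel {X : Type*} {r s t : Setoid X} (hr : ∀ x y, r x y → t x y)
    (hs : ∀ x y, s x y → t x y) {x y : X} (h : (r ⊔ s) x y) : t x y :=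
  (sup_le (show r ≤ t from hr) (show s ≤ t from hs)) h

theorem sup_left_rel {X : Type*} {r s : Setoid X} {x y : X} (h : r x y) : (r ⊔ s) x y :=
  (le_sup_left : r ≤ r ⊔ s) h

theorem sup_right_rel {X : Type*} {r s : Setoid X} {x y : X} (h : s x y) : (r ⊔ s) x y :=
  (le_sup_right : s ≤ r ⊔ s) h

/-- Words of length `n` in which every letter of `A` occurs. -/
def SurjWord (n : ℕ) (A : Type*) : Type _ := {f : Fin n → A // Function.Surjective f}

namespace SurjWord

variable {n : ℕ} {A : Type*}

instance : FunLike (SurjWord n A) (Fin n) A where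
  coe x := x.1
  coe_injective _ _ h := Subtype.ext h

theorem surjective (x : SurjWord n A) : Function.Surjective x := x.2

/-- Renaming of letters. -/
instance : MulAction (Perm A) (SurjWord n A) where
  smul g x := ⟨g ∘ x, g.surjective.comp x.2⟩
  one_smul _ := rfl
  mul_smul _ _ _ := rfl

@[simp] theorem smul_apply (g : Perm A) (x : SurjWord n A) (i : Fin n) : (g • x) i = g (x i) := rfl

/-- Permutation of positions. -/
def permute (x : SurjWord n A) (σ : Perm (Fin n)) : SurjWord n A := ⟨x ∘ σ, x.2.comp σ.surjective⟩

@[simp] theorem permute_apply (x : SurjWord n A) (σ : Perm (Fin n)) (i : Fin n) :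
    x.permute σ i = x (σ i) := rfl

theorem permute_mul (x : SurjWord n A) (σ τ : Perm (Fin n)) :
    x.permute (σ * τ) = (x.permute σ).permute τ := rfl

theorem permute_one (x : SurjWord n A) : x.permute 1 = x := rfl

theorem smul_permute (g : Perm A) (x : SurjWord n A) (σ : Perm (Fin n)) :
    (g • x).permute σ = g • x.permute σ := rfl

theorem permute_swap_swap (x : SurjWord n A) (i j : Fin n) :
    (x.permute (swap i j)).permute (swap i j) = x := by
  rw [← permute_mul, swap_mul_self, permute_one]

theorem smul_cancel {g h : Perm A} {x : SurjWord n A} (e : g • x = h • x) : g = h := by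
  ext a
  obtain ⟨i, rfl⟩ := x.surjective a
  exact DFunLike.congr_fun e i

/-- A letter other than `x i` and `x j` stands only at positions that the swap leaves alone, so `s`
fixes it. -/
theorem eq_swap_of_smul_eq_permute [DecidableEq A] {x : SurjWord n A} {i j : Fin n} {s : Perm A}
    (h : x.permute (swap i j) = s • x) (hne : x.permute (swap i j) ≠ x) :
    s = swap (x i) (x j) := by
  have e : ∀ k, x (swap i j k) = s (x k) := fun k => DFunLike.congr_fun h k
  have hi : s (x i) = x j := by rw [← e, swap_apply_left]
  have hj : s (x j) = x i := by rw [← e, swap_apply_right]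
  ext a
  obtain ⟨k, rfl⟩ := x.surjective a
  by_cases h1 : x k = x i
  · rw [h1, hi, swap_apply_left]
  by_cases h2 : x k = x j
  · rw [h2, hj, swap_apply_right]
  rw [swap_apply_of_ne_of_ne h1 h2, ← e, swap_apply_of_ne_of_ne]
  · rintro rfl; exact h1 rfl
  · rintro rfl; exact h2 rfl

theorem apply_ne_of_permute_ne {x : SurjWord n A} {i j : Fin n}
    (hne : x.permute (swap i j) ≠ x) : x i ≠ x j := by
  intro h
  apply hne
  refine DFunLike.ext _ _ fun k => ?_
  rw [permute_apply]
  rcases eq_or_ne k i with rfl | hi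
  · rw [swap_apply_left, h]
  rcases eq_or_ne k j with rfl | hj
  · rw [swap_apply_right, h]
  rw [swap_apply_of_ne_of_ne hi hj]

/-- Equivalence relations that are invariant under renaming and relate only words that differ by
a permutation of positions. -/
structure IsStable (r : Setoid (SurjWord n A)) : Prop where
  smul : ∀ (g : Perm A) x y, r x y → r (g • x) (g • y)
  permute : ∀ x y, r x y → ∃ σ, y = x.permute σ

theorem IsStable.sup {r s : Setoid (SurjWord n A)} (hr : IsStable r) (hs : IsStable s) :
    IsStable (r ⊔ s) where
  smul g x y h := by
    refine sup_le_of_rel (t := (r ⊔ s).comap (g • ·)) ?_ ?_ h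
    · exact fun x y h => sup_left_rel (hr.smul g x y h)
    · exact fun x y h => sup_right_rel (hs.smul g x y h)
  permute x y h := by
    let t : Setoid (SurjWord n A) :=
      ⟨fun x y => ∃ σ, y = x.permute σ, fun x => ⟨1, rfl⟩,
        fun {x y} ⟨σ, e⟩ => ⟨σ⁻¹, by rw [e, ← permute_mul, mul_inv_cancel, permute_one]⟩,
        fun {x y z} ⟨σ, e⟩ ⟨τ, e'⟩ => ⟨σ * τ, by rw [e', e, permute_mul]⟩⟩
    exact sup_le_of_rel (t := t) hr.permute hs.permute h

theorem IsStable.bot : IsStable (⊥ : Setoid (SurjWord n A)) where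
  smul g _ _ h := congrArg (g • ·) h
  permute _ _ h := ⟨1, Eq.symm h⟩

theorem IsStable.finset_sup {ι : Type*} (s : Finset ι) {f : ι → Setoid (SurjWord n A)}
    (hf : ∀ i, IsStable (f i)) : IsStable (s.sup f) := by
  classical
  induction s using Finset.induction_on with
  | empty => exact IsStable.bot
  | insert i s _ ih => rw [Finset.sup_insert]; exact (hf i).sup ih

/-- The stable equivalence relation generated by a pair. -/
def pairGen (u w : SurjWord n A) : Setoid (SurjWord n A) :=
  Relation.EqvGen.setoid fun x y => ∃ g : Perm A, x = g • u ∧ y = g • w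

theorem pairGen_self (u w : SurjWord n A) : pairGen u w u w :=
  Relation.EqvGen.rel _ _ ⟨1, (one_smul _ _).symm, (one_smul _ _).symm⟩

theorem pairGen_le {u w : SurjWord n A} {t : Setoid (SurjWord n A)}
    (h : ∀ g : Perm A, t (g • u) (g • w)) {x y : SurjWord n A} (hxy : pairGen u w x y) : t x y :=
  Setoid.eqvGen_le (s := t) (by rintro _ _ ⟨g, rfl, rfl⟩; exact h g) hxy

theorem pairGen_stable {u : SurjWord n A} (σ : Perm (Fin n)) :
    IsStable (pairGen u (u.permute σ)) where
  smul g x y h := by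
    refine pairGen_le (t := (pairGen u (u.permute σ)).comap (g • ·)) (fun k => ?_) h
    exact Relation.EqvGen.rel _ _ ⟨g * k, (mul_smul _ _ _).symm, (mul_smul _ _ _).symm⟩
  permute x y h := by
    induction h with
    | rel x y h => obtain ⟨g, rfl, rfl⟩ := h; exact ⟨σ, rfl⟩
    | refl x => exact ⟨1, rfl⟩
    | symm x y _ ih =>
      obtain ⟨σ, rfl⟩ := ih
      exact ⟨σ⁻¹, by rw [← permute_mul, mul_inv_cancel, permute_one]⟩
    | trans x y z _ _ ih ih' =>
      obtain ⟨σ, rfl⟩ := ih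
      obtain ⟨τ, rfl⟩ := ih'
      exact ⟨σ * τ, by rw [permute_mul]⟩

/-- Two generating pairs `{g • u, g • w}` can share a word without coinciding only if `w` is a
renaming of `u`. If that renaming is an involution, pairs that meet still coincide, so no class has
more than two words. -/
theorem pairGen_cases {u w : SurjWord n A} (hk : ∀ k : Perm A, w = k • u → k * k = 1)
    {x y : SurjWord n A} (h : pairGen u w x y) :
    x = y ∨ ∃ g : Perm A, (x = g • u ∧ y = g • w) ∨ (x = g • w ∧ y = g • u) := by
  have key : ∀ g h : Perm A, g • w = h • u → h • w = g • u := by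
    intro g h e
    have e' : w = (g⁻¹ * h) • u := by rw [mul_smul, ← e, inv_smul_smul]
    have := hk _ e'
    rw [e', ← mul_smul]
    congr 1
    calc h * (g⁻¹ * h) = g * ((g⁻¹ * h) * (g⁻¹ * h)) := by group
      _ = g := by rw [this, mul_one]
  induction h with
  | rel x y h => exact Or.inr (h.imp fun g h => Or.inl h)
  | refl x => exact Or.inl rfl
  | symm x y _ ih =>
    rcases ih with rfl | ⟨g, ⟨rfl, rfl⟩ | ⟨rfl, rfl⟩⟩
    · exact Or.inl rfl
    · exact Or.inr ⟨g, Or.inr ⟨rfl, rfl⟩⟩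
    · exact Or.inr ⟨g, Or.inl ⟨rfl, rfl⟩⟩
  | trans x y z _ _ ih ih' =>
    rcases ih with rfl | ⟨g, ⟨rfl, rfl⟩ | ⟨rfl, rfl⟩⟩
    · exact ih'
    · rcases ih' with rfl | ⟨h, ⟨e, rfl⟩ | ⟨e, rfl⟩⟩
      · exact Or.inr ⟨g, Or.inl ⟨rfl, rfl⟩⟩
      · exact Or.inl (key _ _ e).symm
      · rw [smul_cancel e]; exact Or.inl rfl
    · rcases ih' with rfl | ⟨h, ⟨e, rfl⟩ | ⟨e, rfl⟩⟩
      · exact Or.inr ⟨g, Or.inr ⟨rfl, rfl⟩⟩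
      · rw [smul_cancel e]; exact Or.inl rfl
      · exact Or.inl (key _ _ e.symm)

/-- When the generating words are renamings of each other, the classes are the orbits of cosets of
the cyclic group generated by `k`. -/
theorem pairGen_smul_cases {u : SurjWord n A} {k : Perm A} {x y : SurjWord n A}
    (h : pairGen u (k • u) x y) :
    x = y ∨ ∃ g : Perm A, ∃ j ∈ Subgroup.zpowers k, x = g • u ∧ y = (g * j) • u := by
  induction h with
  | rel x y h =>
    obtain ⟨g, rfl, rfl⟩ := h
    exact Or.inr ⟨g, k, Subgroup.mem_zpowers k, rfl, (mul_smul _ _ _).symm⟩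
  | refl x => exact Or.inl rfl
  | symm x y _ ih =>
    rcases ih with rfl | ⟨g, j, hj, rfl, rfl⟩
    · exact Or.inl rfl
    · exact Or.inr ⟨g * j, j⁻¹, inv_mem hj, rfl, by rw [mul_inv_cancel_right]⟩
  | trans x y z _ _ ih ih' =>
    rcases ih with rfl | ⟨g, j, hj, rfl, rfl⟩
    · exact ih'
    · rcases ih' with rfl | ⟨g', j', hj', e, rfl⟩
      · exact Or.inr ⟨g, j, hj, rfl, rfl⟩
      · refine Or.inr ⟨g, j * j', mul_mem hj hj', rfl, ?_⟩
        rw [← smul_cancel e, mul_assoc]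

theorem mul_self_of_permute_swap {u : SurjWord n A} {i j : Fin n} {k : Perm A}
    (h : u.permute (swap i j) = k • u) : k * k = 1 := by
  refine smul_cancel (x := u) ?_
  rw [mul_smul, ← h, ← smul_permute, ← h, permute_swap_swap, one_smul]

/-- All nontrivial pairs of `pairGen u w` are renamings of `(u, w)` or its reverse, so a stable
relation contains either all of them or none. -/
theorem inf_pairGen {r : Setoid (SurjWord n A)} (hr : IsStable r) {u w : SurjWord n A}
    (hk : ∀ k : Perm A, w = k • u → k * k = 1) (huw : ¬ r u w) {x y : SurjWord n A}
    (hxy : r x y) (h : pairGen u w x y) : x = y := by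
  have key : ∀ g : Perm A, ¬ r (g • u) (g • w) := by
    intro g hg
    apply huw
    have := hr.smul g⁻¹ _ _ hg
    rwa [inv_smul_smul, inv_smul_smul] at this
  rcases pairGen_cases hk h with e | ⟨g, ⟨rfl, rfl⟩ | ⟨rfl, rfl⟩⟩
  · exact e
  · exact (key g hxy).elim
  · exact (key g (r.symm' hxy)).elim

/-- The relation of words that differ at most by interchanging the entries in positions `i`, `j`. -/
def swapRel (n : ℕ) (A : Type*) (i j : Fin n) : Setoid (SurjWord n A) where
  r x y := y = x ∨ y = x.permute (swap i j)
  iseqv :=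
    { refl := fun _ => Or.inl rfl
      symm := by
        rintro x y (rfl | rfl)
        · exact Or.inl rfl
        · exact Or.inr (permute_swap_swap _ _ _).symm
      trans := by
        rintro x y z (rfl | rfl) (rfl | rfl)
        · exact Or.inl rfl
        · exact Or.inr rfl
        · exact Or.inr rfl
        · exact Or.inl (permute_swap_swap _ _ _) }

theorem swapRel_stable (i j : Fin n) : IsStable (swapRel n A i j) where
  smul g x y h := by
    rcases h with rfl | rfl
    · exact Or.inl rfl
    · exact Or.inr rfl
  permute x y h := by
    rcases h with rfl | rfl
    · exact ⟨1, rfl⟩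
    · exact ⟨_, rfl⟩

/-- Transpositions generate the symmetric group, so a property lost along a permutation is lost at a
single swap. -/
theorem exists_swap_of_permute {p : SurjWord n A → Prop} {u : SurjWord n A} (hu : p u)
    (σ : Perm (Fin n)) (hσ : ¬ p (u.permute σ)) :
    ∃ v i j, p v ∧ ¬ p (v.permute (swap i j)) := by
  by_contra! H
  apply hσ
  clear hσ
  induction σ using Perm.swap_induction_on' with
  | one => exact hu
  | mul_swap f x y _ ih => rw [permute_mul]; exact H _ _ _ ih

theorem finset_sup_swapRel (u : SurjWord n A) (σ : Perm (Fin n)) :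
    ((Finset.univ : Finset (Fin n × Fin n)).sup fun p => swapRel n A p.1 p.2) u
      (u.permute σ) := by
  by_contra h
  obtain ⟨v, i, j, hv, hw⟩ := exists_swap_of_permute (p := fun v =>
    ((Finset.univ : Finset (Fin n × Fin n)).sup fun p => swapRel n A p.1 p.2) u v)
    (Setoid.refl' _ _) σ h
  refine hw (Setoid.trans' _ hv ?_)
  exact (Finset.le_sup (f := fun p : Fin n × Fin n => swapRel n A p.1 p.2)
    (Finset.mem_univ (i, j))) (Or.inr rfl)

/-! ### Codistributive stable relations -/

theorem inf_finset_sup_le {r : Setoid (SurjWord n A)}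
    (hco : ∀ s t : Setoid (SurjWord n A), IsStable s → IsStable t →
      r ⊓ (s ⊔ t) ≤ (r ⊓ s) ⊔ (r ⊓ t))
    {ι : Type*} (s : Finset ι) {f : ι → Setoid (SurjWord n A)}
    (hf : ∀ i, IsStable (f i)) : r ⊓ s.sup f ≤ s.sup fun i => r ⊓ f i := by
  classical
  induction s using Finset.induction_on with
  | empty => simp
  | insert i s _ ih =>
    rw [Finset.sup_insert, Finset.sup_insert]
    exact (hco _ _ (hf i) (IsStable.finset_sup s hf)).trans (sup_le_sup_left ih _)

/-- The relation of equal content lies below the join of the finitely many `swapRel`s.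
Codistributivity distributes `r` over that join, so some `r ⊓ swapRel` must already move `u`. -/
theorem exists_rel_swap {r : Setoid (SurjWord n A)} (hr : IsStable r)
    (hco : ∀ s t : Setoid (SurjWord n A), IsStable s → IsStable t →
      r ⊓ (s ⊔ t) ≤ (r ⊓ s) ⊔ (r ⊓ t))
    {u v : SurjWord n A} (huv : r u v) (hne : v ≠ u) :
    ∃ i j, r u (u.permute (swap i j)) ∧ u.permute (swap i j) ≠ u := by
  by_contra! H
  obtain ⟨σ, rfl⟩ := hr.permute _ _ huv
  have h := inf_finset_sup_le hco Finset.univ (fun p : Fin n × Fin n => swapRel_stable p.1 p.2)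
    ⟨huv, finset_sup_swapRel u σ⟩
  -- The kernel has two classes, `{u}` and its complement, so lying below it says that `u` is alone
  -- in its class.
  have h' : (Finset.univ.sup fun p : Fin n × Fin n => r ⊓ swapRel n A p.1 p.2) ≤
      Setoid.ker (· = u) := by
    refine Finset.sup_le fun p _ x y hxy => ?_
    obtain ⟨h1, rfl | h2⟩ := hxy
    · exact rfl
    refine propext ⟨?_, ?_⟩
    · rintro rfl; rw [h2] at h1 ⊢; exact H _ _ h1
    · rintro rfl
      have e : x = y.permute (swap p.1 p.2) := by rw [h2, permute_swap_swap]
      rw [e]; rw [e] at h1; exact H _ _ (r.symm' h1)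
  have e : (u = u) = (u.permute σ = u) := h' h
  exact hne (e.mp rfl)

theorem exists_rel_ne {r : Setoid (SurjWord n A)} {u v x : SurjWord n A} (huv : r u v)
    (hne : u ≠ v) (hx : r u x) : ∃ y, r x y ∧ y ≠ x := by
  by_cases h : u = x
  · exact ⟨v, r.trans' (r.symm' hx) huv, fun e => hne (h.trans e.symm)⟩
  · exact ⟨u, r.symm' hx, h⟩

/-- A codistributive stable relation that identifies `u` with another word identifies `u` with
every word of the same content. -/
theorem rel_permute_of_codistributive [Fintype A] [DecidableEq A] {r : Setoid (SurjWord n A)}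
    (hr : IsStable r)
    (hco : ∀ s t : Setoid (SurjWord n A), IsStable s → IsStable t →
      r ⊓ (s ⊔ t) ≤ (r ⊓ s) ⊔ (r ⊓ t))
    {u v : SurjWord n A} (huv : r u v) (hne : u ≠ v) (σ : Perm (Fin n)) :
    r u (u.permute σ) := by
  by_contra H
  obtain ⟨x, i, j, hx, hw⟩ := exists_swap_of_permute (p := fun x => r u x) (r.refl' u) σ H
  obtain ⟨y, hy, hyx⟩ := exists_rel_ne huv hne hx
  obtain ⟨k, l, hz, hzx⟩ := exists_rel_swap hr hco hy hyx
  replace hw : ¬ r x (x.permute (swap i j)) := fun h => hw (r.trans' hx h)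
  obtain ⟨w, hwe⟩ : ∃ w, w = x.permute (swap i j) := ⟨_, rfl⟩
  obtain ⟨z, hze⟩ : ∃ z, z = x.permute (swap k l) := ⟨_, rfl⟩
  have hwx : x.permute (swap i j) ≠ x := fun e => hw (by rw [e])
  have hzw : z = w.permute (swap i j * swap k l) := by
    rw [hwe, permute_mul, permute_swap_swap, hze]
  have hβ : IsStable (pairGen x w) := hwe ▸ pairGen_stable _
  have hγ : IsStable (pairGen w z) := hzw ▸ pairGen_stable _
  rw [← hwe] at hw
  rw [← hze] at hz hzx
  -- The pair `(x, z)` lies in `r` and, via `w`, in the join of the two pair relations.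
  -- Codistributivity applies, and the part of `r` inside `pairGen x w` is trivial.
  have hxz : pairGen w z x z := by
    refine sup_le_of_rel ?_ ?_ (hco _ _ hβ hγ
      ⟨hz, Setoid.trans' _ (sup_left_rel (pairGen_self x w)) (sup_right_rel (pairGen_self w z))⟩)
    · rintro a b ⟨h1, h2⟩
      rw [inf_pairGen hr (fun k e => mul_self_of_permute_swap (hwe ▸ e)) hw h1 h2]
    · exact fun a b h => h.2
  -- If `z = q • w`, parity decides: `g⁻¹` and `q * g⁻¹` are transpositions of letters, so `q` and
  -- its power `m` are even, while `q = g * m` makes `g` even. Otherwise `inf_pairGen` applies to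
  -- `(w, z)`.
  by_cases hk : ∃ q : Perm A, z = q • w
  · obtain ⟨q, hq⟩ := hk
    rw [hq] at hxz
    rcases pairGen_smul_cases hxz with e | ⟨g, m, hm, e1, e2⟩
    · exact hzx (hq.trans e.symm)
    have hs : x.permute (swap i j) = g⁻¹ • x := by rw [← hwe, e1, inv_smul_smul]
    have ht : x.permute (swap k l) = (q * g⁻¹) • x := by
      rw [← hze, hq, mul_smul, ← hs, hwe]
    have hsign := congrArg Perm.sign (eq_swap_of_smul_eq_permute hs hwx)
    have htign := congrArg Perm.sign (eq_swap_of_smul_eq_permute ht (hze ▸ hzx))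
    rw [Perm.sign_swap (apply_ne_of_permute_ne hwx)] at hsign
    rw [Perm.sign_swap (apply_ne_of_permute_ne (hze ▸ hzx)), map_mul, hsign] at htign
    have hq1 : Perm.sign q = 1 := by simpa using htign
    have hm1 : m ∈ (Perm.sign (α := A)).ker :=
      (Subgroup.zpowers_le.2 (show q ∈ (Perm.sign (α := A)).ker from hq1)) hm
    have hg := congrArg Perm.sign (smul_cancel e2)
    rw [map_mul, hq1, show Perm.sign m = 1 from hm1, mul_one] at hg
    rw [map_inv, ← hg] at hsign
    simp at hsign
  · refine hzx (inf_pairGen hr (fun q e => (hk ⟨q, e⟩).elim) (fun h => hw ?_) hz hxz).symm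
    exact r.trans' hz (r.symm' h)

/-! ### Distributive stable relations -/

theorem exists_commute_of_distributive [DecidableEq A] {r : Setoid (SurjWord n A)}
    (hr : IsStable r)
    (hdi : ∀ s t : Setoid (SurjWord n A), IsStable s → IsStable t →
      (r ⊔ s) ⊓ (r ⊔ t) ≤ r ⊔ (s ⊓ t))
    {u v : SurjWord n A} (huv : r u v) (hne : v ≠ u) {i j : Fin n}
    (hw : ¬ r u (u.permute (swap i j))) :
    u.permute (swap i j) = swap (u i) (u j) • u ∧
      ∃ h : Perm A, v = h • u ∧ Commute h (swap (u i) (u j)) := by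
  have hwu : u.permute (swap i j) ≠ u := fun e => hw (by rw [e])
  obtain ⟨w, hwe⟩ : ∃ w, w = u.permute (swap i j) := ⟨_, rfl⟩
  have hwv : ∃ τ, w = v.permute τ := by
    obtain ⟨τ, h⟩ := hr.permute _ _ (r.symm' huv)
    exact ⟨τ * swap i j, by rw [permute_mul, ← h, hwe]⟩
  obtain ⟨τ, hτ⟩ := hwv
  have hβ : IsStable (pairGen u w) := hwe ▸ pairGen_stable _
  have hγ : IsStable (pairGen v w) := hτ ▸ pairGen_stable _
  rw [← hwe] at hw
  -- The pair `(u, w)` lies in the join of `r` with either pair relation, the second route passing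
  -- through `v`. If the two pair relations met trivially, distributivity would put `(u, w)` into
  -- `r`.
  have huw : pairGen v w u w := by
    by_contra hn
    refine hw (sup_le_of_rel (fun _ _ h => h) ?_ (hdi _ _ hβ hγ
      ⟨sup_right_rel (pairGen_self u w),
        Setoid.trans' _ (sup_left_rel huv) (sup_right_rel (pairGen_self v w))⟩))
    rintro x y ⟨h1, h2⟩
    rw [inf_pairGen hγ (fun k e => mul_self_of_permute_swap (hwe ▸ e)) hn h2 h1]
  by_cases hk : ∃ q : Perm A, w = q • v
  · obtain ⟨q, hq⟩ := hk
    rw [hq] at huw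
    rcases pairGen_smul_cases huw with e | ⟨g, m, hm, e1, e2⟩
    · exact (hw (by rw [hq, ← e])).elim
    have hv : v = g⁻¹ • u := by rw [e1, inv_smul_smul]
    have hs : u.permute (swap i j) = (q * g⁻¹) • u := by rw [← hwe, hq, mul_smul, ← hv]
    have hs' := eq_swap_of_smul_eq_permute hs hwu
    refine ⟨hs' ▸ hs, g⁻¹, hv, ?_⟩
    rw [← hs']
    obtain ⟨c, rfl⟩ := hm
    -- Thus `g` is a power of `q`, hence commutes with the transposition `q * g⁻¹`.
    have hg : g = q * (q ^ c)⁻¹ := by rw [eq_mul_inv_iff_mul_eq]; exact (smul_cancel e2).symm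
    have hc : Commute g q := by
      rw [hg]
      exact (Commute.refl q).mul_left ((Commute.refl q).zpow_left c).inv_left
    exact hc.inv_left.mul_right (Commute.refl _)
  · rcases pairGen_cases (fun q e => (hk ⟨q, e⟩).elim) huw with e | ⟨g, ⟨h1, h2⟩ | ⟨h1, h2⟩⟩
    · exact (hw (by rw [← e])).elim
    · have : g = 1 := smul_cancel (x := w) (by rw [← h2, one_smul])
      rw [this, one_smul] at h1
      exact (hne h1.symm).elim
    · exact (hk ⟨_, h2⟩).elim

theorem commute_swap_cases [DecidableEq A] {h : Perm A} {a c : A} (hac : a ≠ c)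
    (hc : Commute h (swap a c)) : (h a = a ∧ h c = c) ∨ (h a = c ∧ h c = a) := by
  have e : h c = swap a c (h a) := by
    have := DFunLike.congr_fun hc.eq a
    rwa [Perm.mul_apply, Perm.mul_apply, swap_apply_left] at this
  by_cases h1 : h a = a
  · exact Or.inl ⟨h1, by rw [e, h1, swap_apply_left]⟩
  by_cases h2 : h a = c
  · exact Or.inr ⟨h2, by rw [e, h2, swap_apply_right]⟩
  rw [swap_apply_of_ne_of_ne h1 h2] at e
  exact (hac (h.injective e.symm)).elim

/-- A distributive stable relation that identifies `u` with another word identifies `u` with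
every word of the same content. -/
theorem rel_permute_of_distributive [DecidableEq A] {r : Setoid (SurjWord n A)}
    (hr : IsStable r)
    (hdi : ∀ s t : Setoid (SurjWord n A), IsStable s → IsStable t →
      (r ⊔ s) ⊓ (r ⊔ t) ≤ r ⊔ (s ⊓ t))
    {u v : SurjWord n A} (huv : r u v) (hne : u ≠ v) (σ : Perm (Fin n)) :
    r u (u.permute σ) := by
  by_contra H
  obtain ⟨x, i, j, hx, hw⟩ := exists_swap_of_permute (p := fun x => r u x) (r.refl' u) σ H
  obtain ⟨y, hy, hyx⟩ := exists_rel_ne huv hne hx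
  replace hw : ¬ r x (x.permute (swap i j)) := fun h => hw (r.trans' hx h)
  have hab : x i ≠ x j := apply_ne_of_permute_ne fun e => hw (by rw [e])
  obtain ⟨hws, h, hyh, hcomm⟩ := exists_commute_of_distributive hr hdi hy hyx hw
  -- The swap of positions `i` and `k` also leaves the class: otherwise the transposition of `x i`
  -- and `x k` would have to commute with that of `x i` and `x j`. So `h` commutes with both
  -- transpositions.
  have hother : ∀ c, c ≠ x i → c ≠ x j →
      (h (x i) = x i ∧ h c = c) ∨ (h (x i) = c ∧ h c = x i) := by
    intro c hca hcb
    obtain ⟨k, rfl⟩ := x.surjective c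
    have hne' : x.permute (swap i k) ≠ x := by
      intro e
      have := DFunLike.congr_fun e i
      rw [permute_apply, swap_apply_left] at this
      exact hca this
    by_cases hrk : r x (x.permute (swap i k))
    · obtain ⟨-, h', e, hc'⟩ := exists_commute_of_distributive hr hdi hrk hne' hw
      rw [eq_swap_of_smul_eq_permute e hne'] at hc'
      have := DFunLike.congr_fun hc'.eq (x i)
      rw [Perm.mul_apply, Perm.mul_apply, swap_apply_left, swap_apply_left,
        swap_apply_of_ne_of_ne hab.symm hcb.symm, swap_apply_of_ne_of_ne hca hcb] at this
      exact (hcb this.symm).elim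
    · obtain ⟨-, h', e, hc'⟩ := exists_commute_of_distributive hr hdi hy hyx hrk
      rw [← smul_cancel (hyh.symm.trans e)] at hc'
      exact commute_swap_cases hca.symm hc'
  -- If `h` fixes `x i`, it fixes every letter and `y = x`. If it exchanges `x i` and `x j`, there
  -- is no third letter and `y` is the swapped word.
  rcases commute_swap_cases hab hcomm with ⟨ha, hb⟩ | ⟨ha, hb⟩
  · apply hyx
    rw [hyh]
    convert one_smul (Perm A) x
    ext c
    by_cases hca : c = x i
    · rw [hca, ha, Perm.one_apply]
    by_cases hcb : c = x j
    · rw [hcb, hb, Perm.one_apply]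
    rcases hother c hca hcb with h | h
    · exact h.2
    · exact (hca (h.1.symm.trans ha)).elim
  · apply hw
    rw [hws]
    convert hy
    rw [hyh]
    congr 1
    ext c
    by_cases hca : c = x i
    · rw [hca, ha, swap_apply_left]
    by_cases hcb : c = x j
    · rw [hcb, hb, swap_apply_right]
    rcases hother c hca hcb with h | h
    · exact (hab (h.1.symm.trans ha)).elim
    · exact (hcb (h.1.symm.trans ha)).elim

end SurjWord
end OvercommutativeTheory

/-! ### The dual lattice of equational theories -/

namespace OvercommutativeTheory

open SemigroupVariety

/-- The list of letters of a word. -/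
def letters (w : FreeSemigroup ℕ) : List ℕ := w.head :: w.tail

theorem letters_injective : Function.Injective letters := by
  rintro ⟨a, l⟩ ⟨b, m⟩ h
  simpa [letters] using h

@[simp] theorem letters_mul (v w : FreeSemigroup ℕ) : letters (v * w) = letters v ++ letters w := rfl

theorem length_letters_pos (w : FreeSemigroup ℕ) : 0 < (letters w).length := Nat.succ_pos _

theorem coe_lift_eq_prod {S : Type*} [CommSemigroup S] (f : ℕ → S) (w : FreeSemigroup ℕ) :
    (FreeSemigroup.lift f w : WithOne S) = ((letters w).map fun i => (f i : WithOne S)).prod := by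
  induction w using FreeSemigroup.recOnMul with
  | ih1 x => simp [letters]
  | ih2 x y hx hy => rw [map_mul, WithOne.coe_mul, hx, hy, letters_mul, List.map_append, List.prod_append]

theorem lift_eq_of_perm {S : Type*} [CommSemigroup S] (f : ℕ → S) {v w : FreeSemigroup ℕ}
    (h : (letters v).Perm (letters w)) : FreeSemigroup.lift f v = FreeSemigroup.lift f w := by
  apply WithOne.coe_injective
  rw [coe_lift_eq_prod, coe_lift_eq_prod]
  exact (h.map _).prod_eq

theorem letters_lift (f : ℕ → FreeSemigroup ℕ) (w : FreeSemigroup ℕ) :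
    letters (FreeSemigroup.lift f w) = (letters w).flatMap fun i => letters (f i) := by
  induction w using FreeSemigroup.recOnMul with
  | ih1 x => simp [letters]
  | ih2 x y hx hy => rw [map_mul, letters_mul, hx, hy, letters_mul, List.flatMap_append]

/-- Fully invariant congruences on the free semigroup that are contained in the commutative one:
the equational theories of overcommutative varieties. -/
structure IsTheory (r : Setoid (FreeSemigroup ℕ)) : Prop where
  mul_left : ∀ a v w, r v w → r (a * v) (a * w)
  mul_right : ∀ a v w, r v w → r (v * a) (w * a)
  subst : ∀ (f : ℕ → FreeSemigroup ℕ) v w, r v w →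
    r (FreeSemigroup.lift f v) (FreeSemigroup.lift f w)
  perm : ∀ v w, r v w → (letters v).Perm (letters w)

/-- Equality of the contents of words. -/
def permSetoid : Setoid (FreeSemigroup ℕ) := (List.isSetoid ℕ).comap letters

theorem IsTheory.sup {r s : Setoid (FreeSemigroup ℕ)} (hr : IsTheory r) (hs : IsTheory s) :
    IsTheory (r ⊔ s) where
  mul_left a _ _ h := sup_le_of_rel (t := (r ⊔ s).comap (a * ·))
    (fun v w h => sup_left_rel (hr.mul_left a v w h))
    (fun v w h => sup_right_rel (hs.mul_left a v w h)) h
  mul_right a _ _ h := sup_le_of_rel (t := (r ⊔ s).comap (· * a))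
    (fun v w h => sup_left_rel (hr.mul_right a v w h))
    (fun v w h => sup_right_rel (hs.mul_right a v w h)) h
  subst f _ _ h := sup_le_of_rel (t := (r ⊔ s).comap (FreeSemigroup.lift f))
    (fun v w h => sup_left_rel (hr.subst f v w h))
    (fun v w h => sup_right_rel (hs.subst f v w h)) h
  perm _ _ h := sup_le_of_rel (t := permSetoid) hr.perm hs.perm h

theorem IsTheory.inf {r s : Setoid (FreeSemigroup ℕ)} (hr : IsTheory r) (hs : IsTheory s) :
    IsTheory (r ⊓ s) where
  mul_left a v w h := ⟨hr.mul_left a v w h.1, hs.mul_left a v w h.2⟩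
  mul_right a v w h := ⟨hr.mul_right a v w h.1, hs.mul_right a v w h.2⟩
  subst f v w h := ⟨hr.subst f v w h.1, hs.subst f v w h.2⟩
  perm v w h := hr.perm v w h.1

/-- The identities of a variety. -/
def theory (V : SemigroupVariety.{u}) : Setoid (FreeSemigroup ℕ) where
  r v w := ∀ S ∈ V.carrier, SatisfiesIdentity S (v, w)
  iseqv :=
    { refl := fun _ _ _ _ => rfl
      symm := fun h S hS f => (h S hS f).symm
      trans := fun h h' S hS f => (h S hS f).trans (h' S hS f) }

theorem lift_lift {S : Type*} [Semigroup S] (f : ℕ → FreeSemigroup ℕ) (g : ℕ → S)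
    (w : FreeSemigroup ℕ) : FreeSemigroup.lift g (FreeSemigroup.lift f w) =
      FreeSemigroup.lift (fun i => FreeSemigroup.lift g (f i)) w := by
  have : (FreeSemigroup.lift g).comp (FreeSemigroup.lift f) =
      FreeSemigroup.lift (fun i => FreeSemigroup.lift g (f i)) := by
    apply FreeSemigroup.hom_ext
    funext i
    simp
  exact DFunLike.congr_fun this w

theorem isTheory_theory {V : SemigroupVariety.{u}} (hV : V ∈ OC) : IsTheory (theory V) where
  mul_left a v w h S hS f := by
    have := h S hS f
    simp only [map_mul] at this ⊢
    rw [this]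
  mul_right a v w h S hS f := by
    have := h S hS f
    simp only [map_mul] at this ⊢
    rw [this]
  subst f v w h S hS g := by
    have := h S hS fun i => FreeSemigroup.lift g (f i)
    simpa only [lift_lift] using this
  perm v w h := by
    -- The multisets of letters form a commutative semigroup, hence a member of the variety, in
    -- which a word evaluates to its content.
    have key : ∀ x, FreeSemigroup.lift
        (fun i => ULift.up.{u} (Multiplicative.ofAdd ({i} : Multiset ℕ))) x =
          ULift.up (Multiplicative.ofAdd (letters x : Multiset ℕ)) := by
      intro x
      induction x using FreeSemigroup.recOnMul with
      | ih1 x => simp [letters]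
      | ih2 x y hx hy => rw [map_mul, hx, hy]; rfl
    have := h (Semigrp.of (ULift.{u} (Multiplicative (Multiset ℕ))))
      (hV _ fun a b => mul_comm (G := ULift.{u} (Multiplicative (Multiset ℕ))) a b)
      (fun i => ULift.up.{u} (Multiplicative.ofAdd ({i} : Multiset ℕ)))
    have h2 := (key v).symm.trans (this.trans (key w))
    exact Multiset.coe_eq_coe.1 (congrArg (fun z => Multiplicative.toAdd (ULift.down z)) h2)

/-- The variety defined by an equivalence relation on words. -/
def ofTheory (r : Setoid (FreeSemigroup ℕ)) : SemigroupVariety.{u} where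
  carrier := semigroupModels {p | r p.1 p.2}
  equational := ⟨_, rfl⟩

/-- A theory as a semigroup congruence. -/
def IsTheory.con {r : Setoid (FreeSemigroup ℕ)} (hr : IsTheory r) : Con (FreeSemigroup ℕ) where
  toSetoid := r
  mul' h h' := r.trans' (hr.mul_right _ _ _ h) (hr.mul_left _ _ _ h')

theorem IsTheory.lift_quotient {r : Setoid (FreeSemigroup ℕ)} (hr : IsTheory r)
    (f : ℕ → FreeSemigroup ℕ) (w : FreeSemigroup ℕ) :
    FreeSemigroup.lift (fun i => ULift.up.{u} (f i : hr.con.Quotient)) w =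
      ULift.up (FreeSemigroup.lift f w : hr.con.Quotient) := by
  induction w using FreeSemigroup.recOnMul with
  | ih1 x => simp
  | ih2 x y hx hy => rw [map_mul, hx, hy, map_mul, Con.coe_mul]; rfl

/-- The quotient of the free semigroup by `r` is a model, because `r` is closed under substitution,
and its generators refute every identity outside `r`. -/
theorem theory_ofTheory {r : Setoid (FreeSemigroup ℕ)} (hr : IsTheory r) :
    theory (ofTheory.{u} r) = r := by
  ext v w
  refine ⟨fun h => ?_, fun h S hS => hS (v, w) h⟩
  have hmem : Semigrp.of (ULift.{u} hr.con.Quotient) ∈ (ofTheory.{u} r).carrier := by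
    rintro ⟨v, w⟩ hvw f
    obtain ⟨g, hg⟩ : ∃ g : ℕ → FreeSemigroup ℕ, f = fun i => ULift.up (g i : hr.con.Quotient) := by
      have : ∀ i, ∃ x : FreeSemigroup ℕ, f i = ULift.up (x : hr.con.Quotient) := by
        intro i
        obtain ⟨x, hx⟩ := Quotient.exists_rep (ULift.down (f i))
        exact ⟨x, congrArg ULift.up hx.symm⟩
      choose g hg using this
      exact ⟨g, funext hg⟩
    rw [hg]
    refine (hr.lift_quotient g v).trans (Eq.trans ?_ (hr.lift_quotient g w).symm)
    exact congrArg ULift.up (hr.con.eq.2 (hr.subst g _ _ hvw))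
  have h1 := h _ hmem fun i => ULift.up (FreeSemigroup.of i : hr.con.Quotient)
  have h2 := (hr.lift_quotient FreeSemigroup.of v).symm.trans
    (h1.trans (hr.lift_quotient FreeSemigroup.of w))
  have h3 := hr.con.eq.1 (congrArg ULift.down h2)
  have h4 : ∀ x, FreeSemigroup.lift FreeSemigroup.of x = x := fun x =>
    DFunLike.congr_fun (FreeSemigroup.lift_comp_of' (MulHom.id (FreeSemigroup ℕ))) x
  rw [h4, h4] at h3
  exact h3

theorem ofTheory_theory (V : SemigroupVariety.{u}) : ofTheory (theory V) = V := by
  obtain ⟨E, hE⟩ := V.equational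
  ext S
  refine ⟨fun hS => ?_, fun hS p hp => hp S hS⟩
  rw [hE]
  exact fun p hp => hS p fun T hT => by rw [hE] at hT; exact hT p hp

theorem theory_injective : Function.Injective theory.{u} := fun V W h => by
  rw [← ofTheory_theory V, h, ofTheory_theory]

theorem ofTheory_mem_OC {r : Setoid (FreeSemigroup ℕ)} (hr : IsTheory r) :
    ofTheory.{u} r ∈ OC := by
  intro S hS p hp f
  let _ : CommSemigroup S := { (inferInstance : Semigroup S) with mul_comm := hS }
  exact lift_eq_of_perm f (hr.perm _ _ hp)

theorem theory_sup (V W : SemigroupVariety.{u}) : theory (V ⊔ W) = theory V ⊓ theory W := by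
  ext v w
  refine ⟨fun h => ⟨fun S hS => h S (subset_generated _ (Or.inl hS)),
    fun S hS => h S (subset_generated _ (Or.inr hS))⟩, fun h S hS => hS (v, w) ?_⟩
  rintro T (hT | hT)
  · exact h.1 T hT
  · exact h.2 T hT

theorem theory_inf {V W : SemigroupVariety.{u}} (hV : V ∈ OC) (hW : W ∈ OC) :
    theory (V ⊓ W) = theory V ⊔ theory W := by
  apply le_antisymm
  · intro v w h
    rw [← theory_ofTheory.{u} ((isTheory_theory hV).sup (isTheory_theory hW))]
    refine fun S hS => h S ⟨?_, ?_⟩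
    · rw [← ofTheory_theory V]; exact fun p hp => hS p (sup_left_rel hp)
    · rw [← ofTheory_theory W]; exact fun p hp => hS p (sup_right_rel hp)
  · exact sup_le (fun v w h S hS => h S hS.1) (fun v w h S hS => h S hS.2)

/-- A theory that is codistributive in the lattice of theories. -/
def IsCodistributiveTheory (r : Setoid (FreeSemigroup ℕ)) : Prop :=
  ∀ s t, IsTheory s → IsTheory t → r ⊓ (s ⊔ t) = (r ⊓ s) ⊔ (r ⊓ t)

/-- A theory that is distributive in the lattice of theories. -/
def IsDistributiveTheory (r : Setoid (FreeSemigroup ℕ)) : Prop :=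
  ∀ s t, IsTheory s → IsTheory t → r ⊔ (s ⊓ t) = (r ⊔ s) ⊓ (r ⊔ t)

theorem isDistributiveElement_iff (V : OC.{u}) :
    IsDistributiveElement V ↔ IsCodistributiveTheory (theory V.1) := by
  constructor
  · intro h s t hs ht
    have := congrArg (fun W : OC.{u} => theory W.1)
      (h ⟨_, ofTheory_mem_OC hs⟩ ⟨_, ofTheory_mem_OC ht⟩)
    simpa only [Sublattice.coe_sup, Sublattice.coe_inf, theory_sup, theory_ofTheory hs,
      theory_ofTheory ht, theory_inf (ofTheory_mem_OC hs) (ofTheory_mem_OC ht),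
      theory_inf (OC.sup_mem V.2 (ofTheory_mem_OC hs)) (OC.sup_mem V.2 (ofTheory_mem_OC ht))]
      using this
  · intro h Y Z
    apply Subtype.ext
    apply theory_injective
    simp only [Sublattice.coe_sup, Sublattice.coe_inf, theory_sup, theory_inf Y.2 Z.2,
      theory_inf (OC.sup_mem V.2 Y.2) (OC.sup_mem V.2 Z.2)]
    exact h _ _ (isTheory_theory Y.2) (isTheory_theory Z.2)

theorem isCodistributiveElement_iff (V : OC.{u}) :
    IsCodistributiveElement V ↔ IsDistributiveTheory (theory V.1) := by
  constructor
  · intro h s t hs ht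
    have := congrArg (fun W : OC.{u} => theory W.1)
      (h ⟨_, ofTheory_mem_OC hs⟩ ⟨_, ofTheory_mem_OC ht⟩)
    simpa only [Sublattice.coe_sup, Sublattice.coe_inf, theory_sup, theory_ofTheory hs,
      theory_ofTheory ht, theory_inf V.2 (ofTheory_mem_OC hs), theory_inf V.2 (ofTheory_mem_OC ht),
      theory_inf V.2 (OC.sup_mem (ofTheory_mem_OC hs) (ofTheory_mem_OC ht))]
      using this
  · intro h Y Z
    apply Subtype.ext
    apply theory_injective
    simp only [Sublattice.coe_sup, Sublattice.coe_inf, theory_sup, theory_inf V.2 Y.2,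
      theory_inf V.2 Z.2, theory_inf V.2 (OC.sup_mem Y.2 Z.2)]
    exact h _ _ (isTheory_theory Y.2) (isTheory_theory Z.2)

end OvercommutativeTheory

/-! ### Restricting theories to fixed length and alphabet, and extending back -/

namespace OvercommutativeTheory

open SurjWord

theorem exists_perm_of_ofFn_perm {α : Type*} [LinearOrder α] {n : ℕ} {f g : Fin n → α}
    (h : (List.ofFn f).Perm (List.ofFn g)) : ∃ σ : Equiv.Perm (Fin n), f = g ∘ σ := by
  have e : f ∘ Tuple.sort f = g ∘ Tuple.sort g := List.ofFn_injective <|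
    (((Equiv.Perm.ofFn_comp_perm _ f).trans h).trans
      (Equiv.Perm.ofFn_comp_perm _ g).symm).eq_of_pairwise'
      (Tuple.monotone_sort f).sortedLE_ofFn.pairwise (Tuple.monotone_sort g).sortedLE_ofFn.pairwise
  refine ⟨Tuple.sort g * (Tuple.sort f)⁻¹, ?_⟩
  funext i
  have := congrFun e ((Tuple.sort f)⁻¹ i)
  simpa using this

variable {n : ℕ} {A : Type*}

/-- The word over the alphabet `ℕ` obtained by naming the letters of a word over `A`. -/
def word (ψ : A → ℕ) (x : SurjWord (n + 1) A) : FreeSemigroup ℕ :=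
  ⟨ψ (x 0), List.ofFn fun i => ψ (x i.succ)⟩

theorem letters_word (ψ : A → ℕ) (x : SurjWord (n + 1) A) :
    letters (word ψ x) = List.ofFn fun i => ψ (x i) := by
  rw [List.ofFn_succ]; rfl

theorem word_eq_iff {ψ ψ' : A → ℕ} {x y : SurjWord (n + 1) A} :
    word ψ x = word ψ' y ↔ ∀ i, ψ (x i) = ψ' (y i) := by
  rw [← letters_injective.eq_iff, letters_word, letters_word, List.ofFn_inj]
  exact funext_iff

theorem word_injective {ψ : A → ℕ} (hψ : Function.Injective ψ) :
    Function.Injective (word ψ : SurjWord (n + 1) A → FreeSemigroup ℕ) := fun _ _ h =>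
  DFunLike.ext _ _ fun i => hψ (word_eq_iff.1 h i)

theorem letters_rename (φ : ℕ → ℕ) (v : FreeSemigroup ℕ) :
    letters (FreeSemigroup.lift (fun i => FreeSemigroup.of (φ i)) v) = (letters v).map φ := by
  rw [letters_lift]
  exact (List.map_eq_flatMap ..).symm

theorem rename_word (φ : ℕ → ℕ) (ψ : A → ℕ) (x : SurjWord (n + 1) A) :
    FreeSemigroup.lift (fun i => FreeSemigroup.of (φ i)) (word ψ x) = word (φ ∘ ψ) x := by
  apply letters_injective
  rw [letters_rename, letters_word, letters_word, List.map_ofFn]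
  rfl

theorem length_word (ψ : A → ℕ) (x : SurjWord (n + 1) A) : (letters (word ψ x)).length = n + 1 := by
  rw [letters_word, List.length_ofFn]

theorem toFinset_word [Fintype A] (ψ : A → ℕ) (x : SurjWord (n + 1) A) :
    (letters (word ψ x)).toFinset = Finset.univ.image ψ := by
  ext k
  rw [letters_word, List.mem_toFinset, List.mem_ofFn']
  simp only [Set.mem_range, Finset.mem_image, Finset.mem_univ, true_and]
  exact ⟨fun ⟨i, hi⟩ => ⟨x i, hi⟩, fun ⟨a, ha⟩ => by
    obtain ⟨i, rfl⟩ := x.surjective a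
    exact ⟨i, ha⟩⟩

theorem exists_eq_word_permute {ψ : A → ℕ} {x : SurjWord (n + 1) A} {v : FreeSemigroup ℕ}
    (h : (letters v).Perm (letters (word ψ x))) : ∃ σ, v = word ψ (x.permute σ) := by
  have hl := h.length_eq
  rw [length_word] at hl
  have hv : letters v = List.ofFn fun i : Fin (n + 1) => (letters v).get (i.cast hl.symm) := by
    rw [← List.ofFn_congr hl, List.ofFn_get]
  rw [hv, letters_word] at h
  obtain ⟨σ, hσ⟩ := exists_perm_of_ofFn_perm h
  refine ⟨σ, letters_injective ?_⟩
  rw [hv, letters_word, hσ]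
  rfl

theorem perm_word_permute (ψ : A → ℕ) (x : SurjWord (n + 1) A) (σ : Equiv.Perm (Fin (n + 1))) :
    (letters (word ψ x)).Perm (letters (word ψ (x.permute σ))) := by
  rw [letters_word, letters_word]
  exact (σ.ofFn_comp_perm fun i => ψ (x i)).symm

theorem exists_rename [Finite A] {ψ ψ' : A → ℕ} (hψ' : Function.Injective ψ') {x y : SurjWord (n + 1) A} (h : word ψ x = word ψ' y) :
    ∃ g : Equiv.Perm A, ψ' = ψ ∘ g := by
  have h1 : ∀ a, ∃ b, ψ b = ψ' a := by
    intro a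
    obtain ⟨i, rfl⟩ := y.surjective a
    exact ⟨x i, word_eq_iff.1 h i⟩
  choose g hg using h1
  have hinj : Function.Injective g := fun a b e => hψ' (by rw [← hg, ← hg, e])
  exact ⟨Equiv.ofBijective g (Finite.injective_iff_bijective.1 hinj), funext fun a => (hg a).symm⟩

theorem word_comp (ψ : A → ℕ) (g : Equiv.Perm A) (x : SurjWord (n + 1) A) :
    word (ψ ∘ g) x = word ψ (g • x) := rfl

theorem IsTheory.isStable {r : Setoid (FreeSemigroup ℕ)} (hr : IsTheory r) {ψ : A → ℕ}
    (hψ : Function.Injective ψ) : IsStable (r.comap (word ψ : SurjWord (n + 1) A → _)) where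
  smul g x y h := by
    have e : ∀ z : SurjWord (n + 1) A, FreeSemigroup.lift
        (fun i => FreeSemigroup.of (Function.extend ψ (ψ ∘ g) id i)) (word ψ z) =
          word ψ (g • z) := by
      intro z
      rw [rename_word, Function.extend_comp hψ, word_comp]
    have := hr.subst (fun i => FreeSemigroup.of (Function.extend ψ (ψ ∘ g) id i)) _ _ h
    rwa [e, e] at this
  permute x y h := by
    obtain ⟨σ, hσ⟩ := exists_eq_word_permute (hr.perm _ _ h).symm
    exact ⟨σ, word_injective hψ hσ⟩

/-- Theories preserve content, so a chain of identities starting at a word named by `ψ` never leaves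
the words named by `ψ`. -/
theorem IsTheory.comap_sup_le {r s : Setoid (FreeSemigroup ℕ)} (hr : IsTheory r)
    (hs : IsTheory s) {ψ : A → ℕ} (hψ : Function.Injective ψ) :
    (r ⊔ s).comap (word ψ : SurjWord (n + 1) A → _) ≤ r.comap (word ψ) ⊔ s.comap (word ψ) := by
  intro x y h
  let q := r.comap (word ψ : SurjWord (n + 1) A → _) ⊔ s.comap (word ψ)
  let t : Setoid (FreeSemigroup ℕ) :=
    { r := fun v w => (letters v).Perm (letters w) ∧ ∀ x y, word ψ x = v → word ψ y = w → q x y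
      iseqv :=
        { refl := fun v => ⟨List.Perm.refl _, fun x y hx hy => by
            rw [word_injective hψ (hx.trans hy.symm)]⟩
          symm := fun h => ⟨h.1.symm, fun x y hx hy => q.symm' (h.2 y x hy hx)⟩
          trans := fun {u v w} h h' => ⟨h.1.trans h'.1, fun x y hx hy => by
            have hp := h.1
            rw [← hx] at hp
            obtain ⟨σ, hσ⟩ := exists_eq_word_permute hp.symm
            exact q.trans' (h.2 x _ hx hσ.symm) (h'.2 _ y hσ.symm hy)⟩ } }
  refine (sup_le_of_rel (t := t) ?_ ?_ h).2 x y rfl rfl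
  · intro v w h
    refine ⟨hr.perm _ _ h, fun x y hx hy => sup_left_rel ?_⟩
    rw [← hx, ← hy] at h
    exact h
  · intro v w h
    refine ⟨hs.perm _ _ h, fun x y hx hy => sup_right_rel ?_⟩
    rw [← hx, ← hy] at h
    exact h

/-- Words that are longer than `n + 1`, or of length `n + 1` with fewer letters than `A`. -/
def IsLarge (n : ℕ) (A : Type*) [Fintype A] (v : FreeSemigroup ℕ) : Prop :=
  n + 1 < (letters v).length ∨
    (letters v).length = n + 1 ∧ (letters v).toFinset.card < Fintype.card A

variable [Fintype A]

theorem IsLarge.of_perm {v w : FreeSemigroup ℕ} (h : (letters v).Perm (letters w))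
    (hv : IsLarge n A v) : IsLarge n A w := by
  unfold IsLarge at *
  rwa [← h.length_eq, ← List.toFinset_eq_of_perm _ _ h]

theorem not_isLarge_word {ψ : A → ℕ} (hψ : Function.Injective ψ) (x : SurjWord (n + 1) A) :
    ¬ IsLarge n A (word ψ x) := by
  rintro (h | ⟨-, h⟩)
  · rw [length_word] at h; exact lt_irrefl _ h
  · rw [toFinset_word, Finset.card_image_of_injective _ hψ, Finset.card_univ] at h
    exact lt_irrefl _ h

/-- The smallest equational theory that restricts to a given stable relation, enlarged by all
balanced identities between large words. -/
def extend (s : Setoid (SurjWord (n + 1) A)) (hs : IsStable s) : Setoid (FreeSemigroup ℕ) where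
  r v w := v = w ∨ ((letters v).Perm (letters w) ∧ IsLarge n A v) ∨
    ∃ ψ : A → ℕ, Function.Injective ψ ∧ ∃ x y, s x y ∧ v = word ψ x ∧ w = word ψ y
  iseqv :=
    { refl := fun _ => Or.inl rfl
      symm := by
        rintro v w (rfl | ⟨h, hl⟩ | ⟨ψ, hψ, x, y, h, rfl, rfl⟩)
        · exact Or.inl rfl
        · exact Or.inr (Or.inl ⟨h.symm, hl.of_perm h⟩)
        · exact Or.inr (Or.inr ⟨ψ, hψ, y, x, s.symm' h, rfl, rfl⟩)
      trans := by
        rintro u v w (rfl | ⟨h, hl⟩ | ⟨ψ, hψ, x, y, h, rfl, rfl⟩) h'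
        · exact h'
        · rcases h' with rfl | ⟨h', hl'⟩ | ⟨ψ, hψ, x, y, h', rfl, rfl⟩
          · exact Or.inr (Or.inl ⟨h, hl⟩)
          · exact Or.inr (Or.inl ⟨h.trans h', hl⟩)
          · exact (not_isLarge_word hψ x (hl.of_perm h)).elim
        · rcases h' with rfl | ⟨h', hl'⟩ | ⟨ψ', hψ', x', y', h', e, rfl⟩
          · exact Or.inr (Or.inr ⟨ψ, hψ, x, y, h, rfl, rfl⟩)
          · exact (not_isLarge_word hψ y hl').elim
          -- The middle word may carry two namings; they differ by a permutation of `A`, which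
          -- stability absorbs.
          · obtain ⟨g, rfl⟩ := exists_rename hψ' e
            rw [word_comp] at e
            refine Or.inr (Or.inr ⟨ψ, hψ, x, g • y', s.trans' h ?_, rfl, rfl⟩)
            rw [word_injective hψ e]
            exact hs.smul g _ _ h' }

theorem extend_perm {s : Setoid (SurjWord (n + 1) A)} (hs : IsStable s) {v w : FreeSemigroup ℕ}
    (h : extend s hs v w) : (letters v).Perm (letters w) := by
  rcases h with rfl | ⟨h, -⟩ | ⟨ψ, hψ, x, y, h, rfl, rfl⟩
  · exact List.Perm.refl _
  · exact h
  · obtain ⟨σ, rfl⟩ := hs.permute _ _ h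
    exact perm_word_permute _ _ _

theorem le_length_of_extend {s : Setoid (SurjWord (n + 1) A)} (hs : IsStable s)
    {v w : FreeSemigroup ℕ} (h : extend s hs v w) (hne : v ≠ w) : n + 1 ≤ (letters v).length := by
  rcases h with rfl | ⟨-, h | h⟩ | ⟨ψ, hψ, x, y, h, rfl, rfl⟩
  · exact (hne rfl).elim
  · exact h.le
  · exact h.1.ge
  · exact (length_word _ _).ge

theorem length_lift_eq {f : ℕ → FreeSemigroup ℕ} (l : List ℕ) :
    l.length ≤ (l.flatMap fun i => letters (f i)).length ∧
      ((l.flatMap fun i => letters (f i)).length ≤ l.length →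
        ∀ i ∈ l, f i = FreeSemigroup.of (f i).head) := by
  induction l with
  | nil => simp
  | cons a l ih =>
    rw [List.flatMap_cons, List.length_append, List.length_cons]
    have ha := length_letters_pos (f a)
    refine ⟨by omega, fun h => ?_⟩
    have h1 : (letters (f a)).length = 1 := by omega
    intro i hi
    rcases List.mem_cons.1 hi with rfl | hi
    · refine FreeSemigroup.ext rfl ?_
      simpa [letters] using h1
    · exact ih.2 (by omega) i hi

theorem lift_congr {f g : ℕ → FreeSemigroup ℕ} {v : FreeSemigroup ℕ}
    (h : ∀ i ∈ letters v, f i = g i) : FreeSemigroup.lift f v = FreeSemigroup.lift g v := by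
  apply letters_injective
  rw [letters_lift, letters_lift, List.flatMap_def, List.flatMap_def,
    List.map_congr_left fun i hi => by rw [h i hi]]

/-- Multiplication lengthens words. A substitution either lengthens a word or renames its letters,
and a renaming that is not injective on `A` loses a letter. So each operation yields a large word or
an injective renaming. -/
theorem isTheory_extend {s : Setoid (SurjWord (n + 1) A)} (hs : IsStable s) :
    IsTheory (extend s hs) where
  mul_left a v w h := by
    by_cases hne : v = w
    · rw [hne]
    refine Or.inr (Or.inl ⟨(extend_perm hs h).append_left (letters a), Or.inl ?_⟩)
    have := le_length_of_extend hs h hne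
    have := length_letters_pos a
    rw [letters_mul, List.length_append]
    omega
  mul_right a v w h := by
    by_cases hne : v = w
    · rw [hne]
    refine Or.inr (Or.inl ⟨(extend_perm hs h).append_right (letters a), Or.inl ?_⟩)
    have := le_length_of_extend hs h hne
    have := length_letters_pos a
    rw [letters_mul, List.length_append]
    omega
  subst f v w h := by
    by_cases hne : v = w
    · rw [hne]
    have hlen := le_length_of_extend hs h hne
    have hperm := extend_perm hs h
    have hperm' : (letters (FreeSemigroup.lift f v)).Perm (letters (FreeSemigroup.lift f w)) := by
      rw [letters_lift, letters_lift]
      exact hperm.flatMap_right _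
    by_cases hlong : n + 1 < (letters (FreeSemigroup.lift f v)).length
    · exact Or.inr (Or.inl ⟨hperm', Or.inl hlong⟩)
    obtain ⟨h1, h2⟩ := length_lift_eq (f := f) (letters v)
    rw [← letters_lift] at h1 h2
    have h3 := h2 (by omega)
    have hv : FreeSemigroup.lift f v =
        FreeSemigroup.lift (fun i => FreeSemigroup.of (f i).head) v := lift_congr h3
    have hw : FreeSemigroup.lift f w =
        FreeSemigroup.lift (fun i => FreeSemigroup.of (f i).head) w :=
      lift_congr fun i hi => h3 i (hperm.mem_iff.2 hi)
    rcases h with rfl | ⟨-, hl⟩ | ⟨ψ, hψ, x, y, h, rfl, rfl⟩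
    · exact (hne rfl).elim
    · refine Or.inr (Or.inl ⟨hperm', ?_⟩)
      rcases hl with hl | ⟨hl, hc⟩
      · omega
      refine Or.inr ⟨by omega, lt_of_le_of_lt ?_ hc⟩
      rw [hv, letters_rename (fun i => (f i).head), show ((letters v).map fun i => (f i).head).toFinset =
        (letters v).toFinset.image fun i => (f i).head by ext; simp]
      exact Finset.card_image_le
    · rw [rename_word (fun i => (f i).head)] at hv hw
      by_cases hinj : Function.Injective ((fun i => (f i).head) ∘ ψ)
      · exact Or.inr (Or.inr ⟨_, hinj, x, y, h, hv, hw⟩)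
      · refine Or.inr (Or.inl ⟨hperm', Or.inr ⟨by rw [hv, length_word], ?_⟩⟩)
        rw [hv, toFinset_word]
        refine lt_of_le_of_ne (Finset.card_image_le) fun e => hinj ?_
        exact Set.injOn_univ.1 (by simpa using Finset.card_image_iff.1 e)
  perm _ _ h := extend_perm hs h

theorem comap_extend {s : Setoid (SurjWord (n + 1) A)} (hs : IsStable s) {ψ : A → ℕ}
    (hψ : Function.Injective ψ) : (extend s hs).comap (word ψ) = s := by
  ext x y
  refine ⟨?_, fun h => Or.inr (Or.inr ⟨ψ, hψ, x, y, h, rfl, rfl⟩)⟩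
  rintro (h | ⟨-, h⟩ | ⟨ψ', hψ', x', y', h, ex, ey⟩)
  · rw [word_injective hψ h]
  · exact (not_isLarge_word hψ x h).elim
  · obtain ⟨g, rfl⟩ := exists_rename hψ' ex
    rw [word_comp] at ex ey
    rw [word_injective hψ ex, word_injective hψ ey]
    exact hs.smul g _ _ h

/-- Every word that is not isolated is identified with all words of the same content. -/
def IsGreedy (r : Setoid (FreeSemigroup ℕ)) : Prop :=
  ∀ u v w, r u v → u ≠ v → (letters u).Perm (letters w) → r u w

theorem isGreedy_of_rel_permute {r : Setoid (FreeSemigroup ℕ)} (hr : IsTheory r)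
    (H : ∀ (n : ℕ) (B : Finset ℕ) (x y : SurjWord (n + 1) B), r (word (↑) x) (word (↑) y) → x ≠ y →
      ∀ σ, r (word (↑) x) (word (↑) (x.permute σ))) : IsGreedy r := by
  intro u v w huv hne huw
  obtain ⟨n, hn⟩ : ∃ n, (letters u).length = n + 1 := ⟨_, rfl⟩
  let x : SurjWord (n + 1) (letters u).toFinset :=
    ⟨fun i => ⟨(letters u).get (i.cast hn.symm), List.mem_toFinset.2 (List.get_mem _ _)⟩, by
      rintro ⟨a, ha⟩
      obtain ⟨i, hi⟩ := List.mem_iff_get.1 (List.mem_toFinset.1 ha)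
      exact ⟨i.cast hn, Subtype.ext hi⟩⟩
  have hx : u = word (↑) x := by
    apply letters_injective
    rw [letters_word]
    change _ = List.ofFn fun i : Fin (n + 1) => (letters u).get (i.cast hn.symm)
    rw [← List.ofFn_congr hn, List.ofFn_get]
  have hv := hr.perm _ _ huv
  rw [hx] at hv huw huv hne ⊢
  obtain ⟨τ, rfl⟩ := exists_eq_word_permute hv.symm
  obtain ⟨σ, rfl⟩ := exists_eq_word_permute huw.symm
  exact H n _ x _ huv (fun e => hne (by rw [← e])) σ

theorem IsCodistributiveTheory.isGreedy {r : Setoid (FreeSemigroup ℕ)} (hr : IsTheory r)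
    (h : IsCodistributiveTheory r) : IsGreedy r := by
  refine isGreedy_of_rel_permute hr fun n B x y hxy hne σ => ?_
  refine rel_permute_of_codistributive (hr.isStable Subtype.val_injective) ?_ hxy hne σ
  intro s t hs ht
  have es := comap_extend hs (ψ := ((↑) : B → ℕ)) Subtype.val_injective
  have et := comap_extend ht (ψ := ((↑) : B → ℕ)) Subtype.val_injective
  have is := isTheory_extend hs
  have it := isTheory_extend ht
  rintro a b ⟨h1, h2⟩
  have h3 : (r ⊓ (extend s hs ⊔ extend t ht)) (word (↑) a) (word (↑) b) := by
    refine ⟨h1, sup_le_of_rel (t := (extend s hs ⊔ extend t ht).comap (word (↑))) ?_ ?_ h2⟩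
    · intro a b h
      rw [← es] at h
      exact sup_left_rel (r := extend s hs) h
    · intro a b h
      rw [← et] at h
      exact sup_right_rel (s := extend t ht) h
  rw [h _ _ is it] at h3
  have h4 := (hr.inf is).comap_sup_le (hr.inf it) (ψ := ((↑) : B → ℕ)) Subtype.val_injective h3
  rw [← es, ← et]
  exact h4

theorem IsDistributiveTheory.isGreedy {r : Setoid (FreeSemigroup ℕ)} (hr : IsTheory r)
    (h : IsDistributiveTheory r) : IsGreedy r := by
  refine isGreedy_of_rel_permute hr fun n B x y hxy hne σ => ?_
  refine rel_permute_of_distributive (hr.isStable Subtype.val_injective) ?_ hxy hne σ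
  intro s t hs ht
  have es := comap_extend hs (ψ := ((↑) : B → ℕ)) Subtype.val_injective
  have et := comap_extend ht (ψ := ((↑) : B → ℕ)) Subtype.val_injective
  have is := isTheory_extend hs
  have it := isTheory_extend ht
  have key : ∀ (q : Setoid (FreeSemigroup ℕ)) {a b : SurjWord (n + 1) B},
      (r.comap (word (↑)) ⊔ q.comap (word (↑))) a b → (r ⊔ q) (word (↑) a) (word (↑) b) := by
    intro q a b h
    refine sup_le_of_rel (t := (r ⊔ q).comap (word (↑))) ?_ ?_ h
    · exact fun a b h => sup_left_rel (r := r) h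
    · exact fun a b h => sup_right_rel (s := q) h
  rintro a b ⟨h1, h2⟩
  rw [← es] at h1
  rw [← et] at h2
  have h3 : ((r ⊔ extend s hs) ⊓ (r ⊔ extend t ht)) (word (↑) a) (word (↑) b) :=
    ⟨key _ h1, key _ h2⟩
  rw [← h _ _ is it] at h3
  have h4 := hr.comap_sup_le (is.inf it) (ψ := ((↑) : B → ℕ)) Subtype.val_injective h3
  rw [← es, ← et]
  exact h4

end OvercommutativeTheory

/-! ### Countability of the greedy theories -/

namespace OvercommutativeTheory

open SemigroupVariety

/-- Up to an injective renaming, every letter occurs in `v` at least as often as in `u`. -/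
def ContentLE (u v : FreeSemigroup ℕ) : Prop :=
  ∃ ψ : ℕ → ℕ, Function.Injective ψ ∧ ((letters u).map ψ).Subperm (letters v)

/-- The list of the multiplicities of the letters. -/
def counts (u : FreeSemigroup ℕ) : List ℕ :=
  (List.range ((letters u).sum + 1)).map fun i => (letters u).count i

theorem counts_getElem?_of_mem {u : FreeSemigroup ℕ} {i : ℕ} (h : i ∈ letters u) :
    (counts u)[i]? = some ((letters u).count i) := by
  have : i < (letters u).sum + 1 := Nat.lt_succ_of_le (List.le_sum_of_mem h)
  simp [counts, this]

theorem eq_count_of_counts_getElem? {u : FreeSemigroup ℕ} {i c : ℕ} (h : (counts u)[i]? = some c) :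
    c = (letters u).count i := by
  simp only [counts, List.getElem?_map, Option.map_eq_some_iff] at h
  obtain ⟨j, hj, rfl⟩ := h
  rw [List.getElem?_eq_some_iff] at hj
  obtain ⟨h, rfl⟩ := hj
  rw [List.getElem_range]

/-- Entry `i` of `counts` belongs to letter `i`, zeros included, so the embedding of indices is
itself the required renaming. -/
theorem ContentLE.of_sublistForall₂ {u v : FreeSemigroup ℕ}
    (h : List.SublistForall₂ (· ≤ ·) (counts u) (counts v)) : ContentLE u v := by
  obtain ⟨l, hl, hs⟩ := List.sublistForall₂_iff.1 h
  obtain ⟨f, hf⟩ := List.sublist_iff_exists_orderEmbedding_getElem?_eq.1 hs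
  refine ⟨f, f.injective, List.subperm_ext_iff.2 fun x hx => ?_⟩
  obtain ⟨i, hi, rfl⟩ := List.mem_map.1 hx
  rw [List.count_map_of_injective _ _ f.injective]
  obtain ⟨h1, e1⟩ := List.getElem?_eq_some_iff.1 (counts_getElem?_of_mem hi)
  obtain ⟨hlen, hle⟩ := List.forall₂_iff_get.1 hl
  have h2 : i < l.length := hlen ▸ h1
  have h3 := hf i
  rw [List.getElem?_eq_getElem h2] at h3
  rw [← eq_count_of_counts_getElem? h3.symm, ← e1]
  exact hle i h1 h2

/-- Higman's lemma for words up to permutation and renaming. -/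
theorem exists_contentLE (f : ℕ → FreeSemigroup ℕ) : ∃ m n, m < n ∧ ContentLE (f m) (f n) := by
  have h := Set.PartiallyWellOrderedOn.partiallyWellOrderedOn_sublistForall₂ (α := ℕ) (· ≤ ·)
    (s := Set.univ) (Set.isPWO_of_wellQuasiOrderedLE _)
  obtain ⟨m, n, hmn, h⟩ := h fun n => ⟨counts (f n), fun _ _ => Set.mem_univ _⟩
  exact ⟨m, n, hmn, ContentLE.of_sublistForall₂ h⟩

/-- The words that a theory identifies with some other word. -/
def nonIsolated (r : Setoid (FreeSemigroup ℕ)) : Set (FreeSemigroup ℕ) := {u | ∃ v, r u v ∧ u ≠ v}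

theorem IsGreedy.nonIsolated_of_contentLE {r : Setoid (FreeSemigroup ℕ)} (hr : IsTheory r)
    (hg : IsGreedy r) {u v : FreeSemigroup ℕ} (hu : u ∈ nonIsolated r) (h : ContentLE u v) :
    v ∈ nonIsolated r := by
  obtain ⟨u', huu', hne⟩ := hu
  obtain ⟨ψ, hψ, hs⟩ := h
  obtain ⟨p, p', hpp', hpne, hpv⟩ : ∃ p p', r p p' ∧ p ≠ p' ∧ (letters p).Perm (letters v) := by
    obtain ⟨l, hl⟩ : ∃ l, (letters v).Perm ((letters u).map ψ ++ l) :=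
      ⟨_, (List.subperm_append_diff_self_of_count_le (List.subperm_ext_iff.1 hs)).symm⟩
    have h1 := hr.subst (fun i => FreeSemigroup.of (ψ i)) _ _ huu'
    have h2 : (letters u).map ψ ≠ (letters u').map ψ := fun e =>
      hne (letters_injective (hψ.list_map e))
    -- The missing letters `l` are appended as a right factor; the empty case is separate because
    -- the free semigroup has no identity.
    cases l with
    | nil =>
      refine ⟨_, _, h1, fun e => h2 ?_, ?_⟩
      · rw [← letters_rename, e, letters_rename]
      · rw [letters_rename]; simpa using hl.symm
    | cons a l =>
      refine ⟨_, _, hr.mul_right ⟨a, l⟩ _ _ h1, fun e => h2 ?_, ?_⟩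
      · have := congrArg letters e
        rw [letters_mul, letters_mul, letters_rename, letters_rename] at this
        exact List.append_cancel_right this
      · rw [letters_mul, letters_rename]; exact hl.symm
  have hv := hg _ _ _ hpp' hpne hpv
  by_cases e : v = p
  · exact ⟨p', r.trans' (r.symm' hv) hpp', e ▸ hpne⟩
  · exact ⟨p, r.symm' hv, e⟩

/-- Without such a finite set, one could choose words successively, none above an earlier one,
against Higman's lemma. -/
theorem exists_finset_generators (N : Set (FreeSemigroup ℕ)) :
    ∃ F : Finset (FreeSemigroup ℕ), ↑F ⊆ N ∧ ∀ v ∈ N, ∃ u ∈ F, ContentLE u v := by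
  by_contra! H
  obtain ⟨f, -, hf⟩ := exists_seq_of_forall_finset_exists (· ∈ N) (fun u v => ¬ ContentLE u v)
    fun s hs => H s hs
  obtain ⟨m, n, hmn, h⟩ := exists_contentLE f
  exact hf m n hmn h

theorem IsGreedy.le_of_nonIsolated {r s : Setoid (FreeSemigroup ℕ)} (hr : IsTheory r)
    (hs : IsGreedy s) (h : nonIsolated r ⊆ nonIsolated s) : r ≤ s := by
  intro u v huv
  by_cases hne : u = v
  · rw [hne]
  obtain ⟨w, huw, hw⟩ := h ⟨v, huv, hne⟩
  exact hs u w v huw hw (hr.perm _ _ huv)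

theorem countable_greedy : {r : Setoid (FreeSemigroup ℕ) | IsTheory r ∧ IsGreedy r}.Countable := by
  have : Countable (FreeSemigroup ℕ) := letters_injective.countable
  refine Set.MapsTo.countable_of_injOn (f := nonIsolated)
    (t := Set.range fun F : Finset (FreeSemigroup ℕ) => {v | ∃ u ∈ F, ContentLE u v}) ?_ ?_
    (Set.countable_range _)
  · rintro r ⟨hr, hg⟩
    obtain ⟨F, hF, h⟩ := exists_finset_generators (nonIsolated r)
    refine ⟨F, Set.Subset.antisymm ?_ h⟩
    rintro v ⟨u, hu, huv⟩
    exact hg.nonIsolated_of_contentLE hr (hF hu) huv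
  · rintro r ⟨hr, hg⟩ s ⟨hs, hg'⟩ e
    exact le_antisymm (hg'.le_of_nonIsolated hr e.subset) (hg.le_of_nonIsolated hs e.superset)

theorem countable_of_isGreedy {P : Set OC.{u}} (h : ∀ V ∈ P, IsGreedy (theory V.1)) :
    P.Countable :=
  Set.MapsTo.countable_of_injOn (f := fun V : OC.{u} => theory V.1)
    (t := {r | IsTheory r ∧ IsGreedy r}) (fun V hV => ⟨isTheory_theory V.2, h V hV⟩)
    (fun _ _ _ _ e => Subtype.ext (theory_injective e)) countable_greedy

/-! ### Infinitely many distributive and codistributive theories -/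

/-- The theory of all balanced identities between words of length at least `n`. -/
def longTheory (n : ℕ) : Setoid (FreeSemigroup ℕ) where
  r v w := v = w ∨ (letters v).Perm (letters w) ∧ n ≤ (letters v).length
  iseqv :=
    { refl := fun _ => Or.inl rfl
      symm := by
        rintro v w (rfl | ⟨h, hl⟩)
        · exact Or.inl rfl
        · exact Or.inr ⟨h.symm, h.length_eq ▸ hl⟩
      trans := by
        rintro u v w (rfl | ⟨h, hl⟩) (rfl | ⟨h', hl'⟩)
        · exact Or.inl rfl
        · exact Or.inr ⟨h', hl'⟩
        · exact Or.inr ⟨h, hl⟩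
        · exact Or.inr ⟨h.trans h', hl⟩ }

theorem isTheory_longTheory (n : ℕ) : IsTheory (longTheory n) where
  mul_left a v w h := by
    rcases h with rfl | ⟨h, hl⟩
    · exact Or.inl rfl
    · refine Or.inr ⟨h.append_left (letters a), ?_⟩
      rw [letters_mul, List.length_append]; omega
  mul_right a v w h := by
    rcases h with rfl | ⟨h, hl⟩
    · exact Or.inl rfl
    · refine Or.inr ⟨h.append_right (letters a), ?_⟩
      rw [letters_mul, List.length_append]; omega
  subst f v w h := by
    rcases h with rfl | ⟨h, hl⟩
    · exact Or.inl rfl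
    · refine Or.inr ⟨?_, ?_⟩
      · rw [letters_lift, letters_lift]; exact h.flatMap_right _
      · rw [letters_lift]; exact hl.trans (length_lift_eq _).1
  perm v w h := by
    rcases h with rfl | ⟨h, -⟩
    · exact List.Perm.refl _
    · exact h

/-- The union of the two relations is already transitive: a nontrivial long identity composed with
one of `s` is again balanced and long. -/
theorem longTheory_sup {n : ℕ} {s : Setoid (FreeSemigroup ℕ)} (hs : IsTheory s)
    {v w : FreeSemigroup ℕ} (h : (longTheory n ⊔ s) v w) :
    (letters v).Perm (letters w) ∧ (n ≤ (letters v).length ∨ s v w) := by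
  have hp := ((isTheory_longTheory n).sup hs).perm _ _ h
  refine ⟨hp, ?_⟩
  by_contra! hn
  let t : Setoid (FreeSemigroup ℕ) :=
    { r := fun v w => longTheory n v w ∨ s v w
      iseqv :=
        { refl := fun v => Or.inr (s.refl' v)
          symm := fun h => h.imp (Setoid.symm' _) s.symm'
          trans := by
            rintro u v w (h | h) (h' | h')
            · exact Or.inl (Setoid.trans' _ h h')
            · rcases h with rfl | ⟨h, hl⟩
              · exact Or.inr h'
              · exact Or.inl (Or.inr ⟨h.trans (hs.perm _ _ h'), hl⟩)
            · rcases h' with rfl | ⟨h', hl⟩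
              · exact Or.inr h
              · have := hs.perm _ _ h
                exact Or.inl (Or.inr ⟨this.trans h', this.length_eq ▸ hl⟩)
            · exact Or.inr (s.trans' h h') } }
  rcases sup_le_of_rel (t := t) (fun _ _ h => Or.inl h) (fun _ _ h => Or.inr h) h with
    (rfl | ⟨-, hl⟩) | h
  · exact hn.2 (s.refl' v)
  · exact absurd hl (not_le.2 hn.1)
  · exact hn.2 h

theorem isDistributiveTheory_longTheory (n : ℕ) : IsDistributiveTheory (longTheory n) := by
  intro s t hs ht
  refine le_antisymm sup_inf_le ?_
  rintro v w ⟨h1, h2⟩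
  obtain ⟨hp, h1⟩ := longTheory_sup hs h1
  obtain ⟨-, h2⟩ := longTheory_sup ht h2
  rcases h1 with h1 | h1
  · exact sup_left_rel (Or.inr ⟨hp, h1⟩)
  rcases h2 with h2 | h2
  · exact sup_left_rel (Or.inr ⟨hp, h2⟩)
  exact sup_right_rel ⟨h1, h2⟩

/-- Identities of theories preserve length, so every link of a chain starting at a long word lies in
`longTheory n`. -/
theorem isCodistributiveTheory_longTheory (n : ℕ) : IsCodistributiveTheory (longTheory n) := by
  intro s t hs ht
  refine le_antisymm ?_ le_inf_sup
  rintro v w ⟨h | ⟨-, hl⟩, h'⟩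
  · rw [h]
  let q : Setoid (FreeSemigroup ℕ) := (longTheory n ⊓ s) ⊔ (longTheory n ⊓ t)
  let p : Setoid (FreeSemigroup ℕ) :=
    { r := fun v w => (letters v).Perm (letters w) ∧ (n ≤ (letters v).length → q v w)
      iseqv :=
        { refl := fun v => ⟨List.Perm.refl _, fun _ => q.refl' v⟩
          symm := fun h => ⟨h.1.symm, fun hl => q.symm' (h.2 (h.1.length_eq ▸ hl))⟩
          trans := fun h h' => ⟨h.1.trans h'.1, fun hl =>
            q.trans' (h.2 hl) (h'.2 (h.1.length_eq ▸ hl))⟩ } }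
  refine (sup_le_of_rel (t := p) ?_ ?_ h').2 hl
  · exact fun v w h => ⟨hs.perm _ _ h, fun hl => sup_left_rel ⟨Or.inr ⟨hs.perm _ _ h, hl⟩, h⟩⟩
  · exact fun v w h => ⟨ht.perm _ _ h, fun hl => sup_right_rel ⟨Or.inr ⟨ht.perm _ _ h, hl⟩, h⟩⟩

theorem longTheory_injective : Function.Injective fun n => longTheory (n + 2) := by
  have key : ∀ m n, longTheory (m + 2) = longTheory (n + 2) → n ≤ m := by
    intro m n h
    -- With `x = x₀` and `y = x₁`, this is `x^(m+1) y ≈ y x^(m+1)`, of the least admissible length.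
    have h1 : longTheory (m + 2) ⟨0, List.replicate m 0 ++ [1]⟩ ⟨1, List.replicate (m + 1) 0⟩ := by
      refine Or.inr ⟨?_, by simp [letters]⟩
      simp only [letters, ← List.cons_append, ← List.replicate_succ]
      exact List.perm_append_singleton _ _
    rw [h] at h1
    rcases h1 with h1 | ⟨-, h1⟩
    · exact absurd (congrArg FreeSemigroup.head h1) zero_ne_one
    · simpa [letters] using h1
  exact fun m n h => le_antisymm (key _ _ h.symm) (key _ _ h)

theorem infinite_of_longTheory {P : Set OC.{u}}
    (h : ∀ n (V : OC.{u}), theory V.1 = longTheory n → V ∈ P) : P.Infinite := by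
  refine Set.infinite_of_injective_forall_mem
    (f := fun n => (⟨_, ofTheory_mem_OC (isTheory_longTheory (n + 2))⟩ : OC.{u})) ?_
    fun n => h _ _ (theory_ofTheory (isTheory_longTheory (n + 2)))
  intro m n e
  apply longTheory_injective
  have := congrArg (fun V : OC.{u} => theory V.1) e
  simpa only [theory_ofTheory (isTheory_longTheory _)] using this

end OvercommutativeTheory

open OvercommutativeTheory

theorem corollary2p2 :
    ({V : SemigroupVariety.OC.{u} | IsDistributiveElement V}.Countable ∧
      {V : SemigroupVariety.OC.{u} | IsDistributiveElement V}.Infinite) ∧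
    ({V : SemigroupVariety.OC.{u} | IsCodistributiveElement V}.Countable ∧
      {V : SemigroupVariety.OC.{u} | IsCodistributiveElement V}.Infinite) := by
  refine ⟨⟨countable_of_isGreedy fun V hV => ?_, infinite_of_longTheory fun n V hV => ?_⟩,
    countable_of_isGreedy fun V hV => ?_, infinite_of_longTheory fun n V hV => ?_⟩
  · exact ((isDistributiveElement_iff V).1 hV).isGreedy (isTheory_theory V.2)
  · exact (isDistributiveElement_iff V).2 (hV ▸ isCodistributiveTheory_longTheory n)
  · exact ((isCodistributiveElement_iff V).1 hV).isGreedy (isTheory_theory V.2)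
  · exact (isCodistributiveElement_iff V).2 (hV ▸ isDistributiveTheory_longTheory n)
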